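/- Let $G$ be a topological group and $X$ a topological space. Let $\eta : G*X \to X$, $(g,x)\mapsto g\cdot x$, be a partial action of $G$ on $X$, that is, a function with domain $G*X\subseteq G\times X$ such that for all $g,h\in G$ and $x\in X$: if $(g,x)\in G*X$, then $(g^{-1},g\cdot x)\in G*X$ and $g^{-1}\cdot(g\cdot x)=x$; if $(h,x)\in G*X$ and $(g,h\cdot x)\in G*X$, then $(gh,x)\in G*X$ and $g\cdot(h\cdot x)=(gh)\cdot x$; and $(1,x)\in G*X$ with $1\cdot x=x$. For $g\in G$ put $X_g=\{x\in X : (g^{-1},x)\in G*X\}$. Assume that $\eta$ is continuous, where $G*X$ carries the subspace topology of $G\times X$, that every $X_g$ is open in $X$, and that every map $\eta_g: X_{g^{-1}}\to X_g$, $x\mapsto g\cdot x$, is a homeomorphism. Let $X/\!\sim_G$ be the orbit space, with the quotient topology, of the equivalence relation $x\sim_G y \iff g\cdot x=y$ for some $g$ with $(g,x)\in G*X$. Let $X_G=(G\times X)/R$ be the enveloping space, with the quotient topology, where $(g,x)\,R\,(h,y)\iff (h^{-1}g,x)\in G*X$ and $(h^{-1}g)\cdot x=y$; the group $G$ acts (globally)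 on $X_G$ by $g\cdot[h,x]=[gh,x]$, and $X_G/\!\sim_G$ is the orbit space of this action, with the quotient topology. Consider the conditions (i) $G$ is countably compact and $X_G$ is metrizable; (ii) $G$ is compact and metrizable, $X$ is metrizable, and $G*X$ is closed in $G\times X$. If (i) or (ii) holds, then the topology of $X$ is induced by a metric $\rho$ with $\rho(g\cdot x,g\cdot y)=\rho(x,y)$ for all $g\in G$ and $x,y\in X_{g^{-1}}$, and the topology of $X_G$ is induced by a metric $\rho'$ with $\rho'(g\cdot a,g\cdot b)=\rho'(a,b)$ for all $g\in G$ and $a,b\in X_G$. Moreover, if (i) holds and $X_G/\!\sim_G$ is $T_1$, then $X/\!\sim_G$ is metrizable. -/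

import Mathlib

/-- A (set-theoretic) partial action of a group `G` on a set `X`: a function `(g, x) ↦ g · x`
defined on a subset `dom` (written `G * X` on paper) of `G × X`; `∃ g · x` means `(g, x) ∈ dom`. -/
structure PartialAction (G : Type*) (X : Type*) [Group G] where
  /-- The domain `G * X`. -/
  dom : Set (G × X)
  /-- The map `G * X → X`. -/
  act : dom → X
  /-- If `∃ g · x`, then `∃ g⁻¹ · (g · x)` and `g⁻¹ · (g · x) = x`. -/
  inv_act : ∀ (g : G) (x : X) (h : (g, x) ∈ dom),
    ∃ h' : (g⁻¹, act ⟨(g, x), h⟩) ∈ dom, act ⟨(g⁻¹, act ⟨(g, x), h⟩), h'⟩ = x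
  /-- If `∃ g · (h · x)`, then `∃ (g h) · x` and `g · (h · x) = (g h) · x`. -/
  act_act : ∀ (g h : G) (x : X) (hx : (h, x) ∈ dom) (hgx : (g, act ⟨(h, x), hx⟩) ∈ dom),
    ∃ h' : (g * h, x) ∈ dom, act ⟨(g, act ⟨(h, x), hx⟩), hgx⟩ = act ⟨(g * h, x), h'⟩
  /-- `∃ 1 · x` and `1 · x = x`. -/
  one_act : ∀ x : X, ∃ h : ((1 : G), x) ∈ dom, act ⟨(1, x), h⟩ = x

namespace PartialAction

variable {G : Type*} {X : Type*} [Group G]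

section Algebra

variable (η : PartialAction G X)

/-- The set `X_g = {x | ∃ g⁻¹ · x}`. -/
def domAt (g : G) : Set X := {x | (g⁻¹, x) ∈ η.dom}

theorem mem_dom_of_mem_domAt_inv {g : G} {x : X} (hx : x ∈ η.domAt g⁻¹) : (g, x) ∈ η.dom := by
  simpa [domAt] using hx

/-- The map `η_g : X_{g⁻¹} → X_g`, `x ↦ g · x`. -/
def mapAt (g : G) (x : η.domAt g⁻¹) : η.domAt g :=
  ⟨η.act ⟨(g, x.1), η.mem_dom_of_mem_domAt_inv x.2⟩, (η.inv_act g x.1 _).1⟩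

/-- The orbit equivalence relation: `x ∼ y` iff `∃ g · x` and `g · x = y` for some `g`. -/
def orbitSetoid : Setoid X where
  r x y := ∃ (g : G) (h : (g, x) ∈ η.dom), η.act ⟨(g, x), h⟩ = y
  iseqv :=
    { refl := fun x => ⟨1, η.one_act x⟩
      symm := by
        rintro x _ ⟨g, h, rfl⟩
        exact ⟨g⁻¹, η.inv_act g x h⟩
      trans := by
        rintro x _ _ ⟨g, h, rfl⟩ ⟨k, h', rfl⟩
        obtain ⟨h'', e⟩ := η.act_act k g x h h'
        exact ⟨k * g, h'', e.symm⟩ }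

/-- The orbit space `X / ∼_G`. -/
def OrbitSpace : Type _ := Quotient η.orbitSetoid

/-- The relation `R` on `G × X` that defines the enveloping space: `(g, x) R (h, y)` iff
`x ∈ X_{g⁻¹ h}`, that is `∃ (h⁻¹ g) · x`, and `(h⁻¹ g) · x = y`. -/
def envSetoid : Setoid (G × X) where
  r p q := ∃ h : (q.1⁻¹ * p.1, p.2) ∈ η.dom, η.act ⟨(q.1⁻¹ * p.1, p.2), h⟩ = q.2
  iseqv :=
    { refl := by
        rintro ⟨g, x⟩
        simpa using η.one_act x
      symm := by
        rintro ⟨g, x⟩ ⟨h, y⟩ ⟨hd, e⟩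
        dsimp only at hd e ⊢
        subst e
        simpa using η.inv_act (h⁻¹ * g) x hd
      trans := by
        rintro ⟨g, x⟩ ⟨h, y⟩ ⟨k, z⟩ ⟨hd, e⟩ ⟨hd', e'⟩
        dsimp only at hd e hd' e' ⊢
        subst e
        subst e'
        obtain ⟨h'', e⟩ := η.act_act (k⁻¹ * h) (h⁻¹ * g) x hd hd'
        have e1 : k⁻¹ * h * (h⁻¹ * g) = k⁻¹ * g := by group
        simp only [e1] at h'' e
        exact ⟨h'', e.symm⟩ }

/-- The enveloping space (globalization) `X_G = (G × X) / R`. -/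
def EnvelopingSpace : Type _ := Quotient η.envSetoid

/-- The enveloping action `g • [h, x] = [g h, x]` of `G` on `X_G`. -/
instance : MulAction G η.EnvelopingSpace where
  smul g := Quotient.map (fun p => (g * p.1, p.2)) (by
    rintro ⟨h, x⟩ ⟨k, y⟩ ⟨hd, e⟩
    have e1 : (g * k)⁻¹ * (g * h) = k⁻¹ * h := by group
    change ∃ h' : ((g * k)⁻¹ * (g * h), x) ∈ η.dom, η.act ⟨((g * k)⁻¹ * (g * h), x), h'⟩ = y
    simp only [e1]
    exact ⟨hd, e⟩)
  one_smul := by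
    rintro ⟨h, x⟩
    exact congrArg (Quotient.mk η.envSetoid) (Prod.ext (one_mul h) rfl)
  mul_smul g k := by
    rintro ⟨h, x⟩
    exact congrArg (Quotient.mk η.envSetoid) (Prod.ext (mul_assoc g k h) rfl)

end Algebra

section Topology

variable [TopologicalSpace G] [τ : TopologicalSpace X] (η : PartialAction G X)

/-- `η` is continuous: `G * X → X` is continuous, `G * X` having the subspace topology. -/
def IsContinuous : Prop := Continuous η.act

/-- `η` is topological: every `X_g` is open and every `η_g : X_{g⁻¹} → X_g` is a homeomorphism. -/
def IsTopological : Prop := ∀ g : G, IsOpen (η.domAt g) ∧ IsHomeomorph (η.mapAt g)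

/-- The quotient topology on the orbit space. -/
instance : TopologicalSpace η.OrbitSpace :=
  inferInstanceAs (TopologicalSpace (Quotient η.orbitSetoid))

/-- The quotient topology (of the product topology on `G × X`) on the enveloping space. -/
instance : TopologicalSpace η.EnvelopingSpace :=
  inferInstanceAs (TopologicalSpace (Quotient η.envSetoid))

/-- `X` has a metric that induces its topology and is `η`-invariant:
`ρ (g · x) (g · y) = ρ x y` for all `g` and all `x, y ∈ X_{g⁻¹}`. -/
def HasInvariantMetric : Prop :=
  ∃ ρ : MetricSpace X,
    ρ.toUniformSpace.toTopologicalSpace = τ ∧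
    ∀ (g : G) (x y : η.domAt g⁻¹), ρ.dist (η.mapAt g x) (η.mapAt g y) = ρ.dist x y

end Topology

end PartialAction

/-- `Y` has a metric that induces its topology and is invariant under the (global) action
of `G` on `Y`. -/
def HasInvariantMetric (G : Type*) (Y : Type*) [Group G] [MulAction G Y]
    [τ : TopologicalSpace Y] : Prop :=
  ∃ ρ : MetricSpace Y,
    ρ.toUniformSpace.toTopologicalSpace = τ ∧
    ∀ (g : G) (x y : Y), ρ.dist (g • x) (g • y) = ρ.dist x y

/-! Let `f` be a continuous open surjection and send each point to its fibre, a point of the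
hyperspace of its domain. If `f` is proper, or is the orbit map of an isometric action, then this is
an embedding for the Hausdorff distance. The first case makes `X_G` metrizable under (ii), since
`(h, y) R (h * k⁻¹, k · y)` parametrizes the classes of `R` by `G * X`, which makes `G × X → X_G`
open and, when `G` is compact and `G * X` closed, proper. The second case handles the orbit space of
`X_G`, which is homeomorphic to that of `X`.

A continuous action of a countably compact group is equicontinuous: projection along a countably
compact factor is closed over a sequential space. Hence `y ↦ (g ↦ g • y)` embeds the space into
bounded functions with the uniform distance, on which `G` acts isometrically by right translation.
Finally `X` embeds equivariantly into `X_G`, so an invariant metric restricts to `X`. -/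

open Filter Function Set Topology TopologicalSpace Uniformity

section Fibers

variable {A B : Type*}

theorem continuous_fiber_vietoris [TopologicalSpace A] [TopologicalSpace B] {f : A → B}
    (hopen : IsOpenMap f) (hclosed : IsClosedMap f) :
    Continuous[_, TopologicalSpace.vietoris A] fun b => f ⁻¹' {b} := by
  have hpow (S : Set A) : (fun b => f ⁻¹' {b}) ⁻¹' S.powerset = (f '' Sᶜ)ᶜ := by
    ext b
    simp only [mem_preimage, mem_powerset_iff, mem_compl_iff, mem_image, subset_def,
      mem_singleton_iff]
    grind
  refine vietoris.continuous_iff.2 ⟨fun U hU => ?_, fun C hC => ?_⟩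
  · rw [hpow]
    exact (hclosed _ hU.isClosed_compl).isOpen_compl
  · rw [hpow]
    exact (hopen _ hC.isOpen_compl).isClosed_compl

attribute [local instance] UniformSpace.hausdorff

theorem isInducing_fiber [UniformSpace A] [TopologicalSpace B] {f : A → B} (hf : Continuous f)
    (hsurj : Surjective f) (hfib : Continuous fun b => f ⁻¹' {b}) :
    IsInducing fun b => f ⁻¹' {b} := by
  refine ⟨le_antisymm hfib.le_induced fun V hV => isOpen_induced_iff.2
    ⟨{S | (S ∩ f ⁻¹' V).Nonempty},
      UniformSpace.hausdorff.isOpen_inter_nonempty_of_isOpen (hV.preimage hf), ?_⟩⟩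
  ext b
  obtain ⟨a, rfl⟩ := hsurj b
  refine ⟨?_, fun ha => ⟨a, rfl, ha⟩⟩
  rintro ⟨a', ha', hV'⟩
  exact mem_of_eq_of_mem ha'.symm hV'

theorem pseudoMetrizableSpace_of_continuous_fiber [PseudoEMetricSpace A] [TopologicalSpace B]
    {f : A → B} (hf : Continuous f) (hsurj : Surjective f)
    (hfib : Continuous fun b => f ⁻¹' {b}) : PseudoMetrizableSpace B :=
  let _ : PseudoEMetricSpace (Set A) := .hausdorff
  (isInducing_fiber hf hsurj hfib).pseudoMetrizableSpace

theorem pseudoMetrizableSpace_of_isProperMap_of_isOpenMap [TopologicalSpace A]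
    [PseudoMetrizableSpace A] [TopologicalSpace B] {f : A → B} (hsurj : Surjective f)
    (hproper : IsProperMap f) (hopen : IsOpenMap f) : PseudoMetrizableSpace B := by
  let _ := pseudoMetrizableSpacePseudoMetric A
  refine pseudoMetrizableSpace_of_continuous_fiber hproper.continuous hsurj
    (continuous_iff_continuousAt.2 fun b => ?_)
  have hcompact : IsCompact (f ⁻¹' {b}) := hproper.isCompact_preimage isCompact_singleton
  rw [ContinuousAt, hcompact.nhds_hausdorff_eq_nhds_vietoris]
  exact @Continuous.tendsto _ _ _ (.vietoris A) _
    (continuous_fiber_vietoris hopen hproper.isClosedMap) b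

theorem t1Space_of_surjective_of_isClosedMap [TopologicalSpace A] [T1Space A] [TopologicalSpace B]
    {f : A → B} (hsurj : Surjective f) (hclosed : IsClosedMap f) : T1Space B := by
  refine ⟨hsurj.forall.2 fun a => ?_⟩
  simpa only [image_singleton] using hclosed _ (isClosed_singleton (x := a))

theorem pseudoMetrizableSpace_orbitRel_quotient (G Y : Type*) [Group G] [PseudoEMetricSpace Y]
    [MulAction G Y] [IsIsometricSMul G Y] :
    PseudoMetrizableSpace (Quotient (MulAction.orbitRel G Y)) := by
  have hmk : IsQuotientMap (Quotient.mk (MulAction.orbitRel G Y)) := isQuotientMap_quotient_mk'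
  have hfiber : (fun q => Quotient.mk (MulAction.orbitRel G Y) ⁻¹' {q}) ∘ Quotient.mk _ =
      fun y => MulAction.orbit G y := by
    ext y z
    exact Quotient.eq
  let _ : PseudoEMetricSpace (Set Y) := .hausdorff
  refine pseudoMetrizableSpace_of_continuous_fiber hmk.continuous hmk.surjective
    (hmk.continuous_iff.2 ?_)
  rw [hfiber]
  refine (LipschitzWith.of_edist_le fun x y => ?_).continuous
  refine Metric.hausdorffEDist_le_of_mem_edist ?_ ?_
  · rintro _ ⟨g, rfl⟩
    exact ⟨g • y, ⟨g, rfl⟩, (edist_smul_left g x y).le⟩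
  · rintro _ ⟨g, rfl⟩
    exact ⟨g • x, ⟨g, rfl⟩, (edist_smul_left g y x).trans_le (edist_comm y x).le⟩

end Fibers

section KernelPair

variable {A B E : Type*}

/-- `(r, p)` maps `E` onto the kernel pair `{(a, b) | f a = f b}` of `f`. Saturations are then
`p '' (r ⁻¹' s)`, so openness and properness of `p` pass to `f`. -/
def ParametrizesKernelPair (f : A → B) (r p : E → A) : Prop :=
  ∀ a b, f a = f b ↔ ∃ e, r e = a ∧ p e = b

namespace ParametrizesKernelPair

variable {f : A → B} {r p : E → A}

theorem preimage_image (h : ParametrizesKernelPair f r p) (s : Set A) :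
    f ⁻¹' (f '' s) = p '' (r ⁻¹' s) := by
  ext b
  simp only [mem_preimage, mem_image, h _ b]
  grind

variable [TopologicalSpace A] [TopologicalSpace B] [TopologicalSpace E]

theorem isOpenMap (h : ParametrizesKernelPair f r p) (hf : IsQuotientMap f) (hr : Continuous r)
    (hp : IsOpenMap p) : IsOpenMap f := by
  intro s hs
  rw [← hf.isOpen_preimage, h.preimage_image]
  exact hp _ (hs.preimage hr)

theorem isProperMap (h : ParametrizesKernelPair f r p) (hf : IsQuotientMap f) (hr : Continuous r)
    (hp : IsProperMap p) : IsProperMap f := by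
  refine isProperMap_iff_isClosedMap_and_compact_fibers.2
    ⟨hf.continuous, fun s hs => ?_, hf.surjective.forall.2 fun b => ?_⟩
  · rw [← hf.isClosed_preimage, h.preimage_image]
    exact hp.isClosedMap _ (hs.preimage hr)
  · have hfiber : f ⁻¹' {f b} = r '' (p ⁻¹' {b}) := by
      ext a
      simp only [mem_preimage, mem_singleton_iff, h a b, mem_image]
      grind
    rw [hfiber]
    exact (hp.isCompact_preimage isCompact_singleton).image hr

end ParametrizesKernelPair

end KernelPair

section CountablyCompact

theorem isClosedMap_snd_of_countablyCompactSpace {K Y : Type*} [TopologicalSpace K]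
    [CountablyCompactSpace K] [TopologicalSpace Y] [SequentialSpace Y] :
    IsClosedMap (Prod.snd : K × Y → Y) := by
  refine fun C hC => IsSeqClosed.isClosed fun y b hy hyb => ?_
  choose p hpC hpy using hy
  obtain ⟨a, -, ha⟩ := (CountablyCompactSpace.isCountablyCompact_univ (E := K)).seq_clusterPt
    (fun n => (p n).1) (by simp)
  have hab : MapClusterPt (a, b) atTop p := by
    refine mapClusterPt_iff_frequently.2 fun W hW => ?_
    obtain ⟨U, hU, V, hV, hUV⟩ := mem_nhds_prod_iff.1 hW
    refine ((mapClusterPt_iff_frequently.1 ha U hU).and_eventually (hyb hV)).mono ?_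
    exact fun n ⟨hnU, hnV⟩ => hUV ⟨hnU, (hpy n).symm ▸ hnV⟩
  exact ⟨(a, b), hC.mem_of_mapClusterPt hab (.of_forall hpC), rfl⟩

theorem equicontinuous_of_countablyCompactSpace {K Y Z : Type*} [TopologicalSpace K]
    [CountablyCompactSpace K] [TopologicalSpace Y] [SequentialSpace Y] [UniformSpace Z]
    {F : K → Y → Z} (hF : Continuous (uncurry F)) : Equicontinuous F := by
  intro x U hU
  obtain ⟨V, ⟨hV, hVo⟩, hVU⟩ := uniformity_hasBasis_open.mem_iff.1 hU
  let C : Set (K × Y) := {p | (F p.1 x, F p.1 p.2) ∉ V}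
  have hC : IsClosed C := (hVo.preimage (f := fun p : K × Y => (F p.1 x, F p.1 p.2))
    ((hF.comp (by fun_prop : Continuous fun p : K × Y => (p.1, x))).prodMk hF)).isClosed_compl
  have hx : x ∈ (Prod.snd '' C)ᶜ := by
    rintro ⟨⟨k, _⟩, hk, rfl⟩
    exact hk (refl_mem_uniformity hV)
  filter_upwards [(isClosedMap_snd_of_countablyCompactSpace C hC).isOpen_compl.mem_nhds hx]
    with y hy k
  by_contra hk
  exact hy ⟨(k, y), fun h => hk (hVU h), rfl⟩

theorem continuousInv_of_compactSpace (G : Type*) [Group G] [TopologicalSpace G] [ContinuousMul G]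
    [CompactSpace G] [T1Space G] : ContinuousInv G := by
  refine ⟨continuous_iff_isClosed.2 fun C hC => ?_⟩
  have h : Inv.inv ⁻¹' C = Prod.snd '' ({p : G × G | p.1 * p.2 = 1} ∩ Prod.fst ⁻¹' C) := by
    ext x
    simp [mul_eq_one_iff_eq_inv]
  rw [h]
  exact isClosedMap_snd_of_compactSpace _
    ((isClosed_singleton.preimage continuous_mul).inter (hC.preimage continuous_fst))

end CountablyCompact

section InvariantMetric

open scoped UniformConvergence

theorem exists_metricSpace_dist_le_one (Y : Type*) [τ : TopologicalSpace Y] [MetrizableSpace Y] :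
    ∃ ρ : MetricSpace Y, ρ.toUniformSpace.toTopologicalSpace = τ ∧ ∀ x y, ρ.dist x y ≤ 1 := by
  let _ := metrizableSpaceMetric Y
  have htriangle (x y z : Y) : min 1 (dist x z) ≤ min 1 (dist x y) + min 1 (dist y z) := by
    have := dist_triangle x y z
    have := dist_nonneg (x := x) (y := y)
    have := dist_nonneg (x := y) (y := z)
    grind
  have hopen (s : Set Y) : IsOpen s ↔ ∀ x ∈ s, ∃ ε > 0, ∀ y, min 1 (dist x y) < ε → y ∈ s := by
    simp only [Metric.isOpen_iff, subset_def, Metric.mem_ball']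
    refine forall₂_congr fun x _ => ⟨fun ⟨ε, hε, h⟩ => ⟨min 1 ε, by positivity, fun y hy => ?_⟩,
      fun ⟨ε, hε, h⟩ => ⟨ε, hε, fun y hy => h y (min_lt_of_right_lt hy)⟩⟩
    exact h y (by grind)
  exact ⟨.ofDistTopology (fun x y => min 1 (dist x y)) (by simp) (by simp [dist_comm]) htriangle
    hopen fun x y h => dist_eq_zero.1 (by grind), rfl, fun x y => min_le_left _ _⟩

variable {G Y : Type*} [Group G] [MulAction G Y]

/-- The orbit map `g ↦ g • y`, as a point of the space of functions `G → Y` with the topology of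
uniform convergence. -/
def orbitFun (G : Type*) {Y : Type*} [Group G] [MulAction G Y] (y : Y) : G →ᵤ Y :=
  UniformFun.ofFun fun g => g • y

theorem leftInverse_eval_one_orbitFun :
    LeftInverse (fun f : G →ᵤ Y => UniformFun.toFun f 1) (orbitFun G) :=
  one_smul G

theorem isEmbedding_orbitFun [PseudoEMetricSpace Y]
    (h : Equicontinuous fun (g : G) (y : Y) => g • y) : IsEmbedding (orbitFun G (Y := Y)) :=
  leftInverse_eval_one_orbitFun.isEmbedding (UniformFun.lipschitzWith_eval 1).continuous
    (equicontinuous_iff_continuous.1 h)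

theorem dist_orbitFun_smul [PseudoMetricSpace Y] [BoundedSpace Y] (g : G) (x y : Y) :
    dist (orbitFun G (g • x)) (orbitFun G (g • y)) = dist (orbitFun G x) (orbitFun G y) := by
  simp only [UniformFun.dist_def, orbitFun, UniformFun.toFun_ofFun, ← mul_smul]
  exact (Equiv.mulRight g).iSup_comp (g := fun k => dist (k • x) (k • y))

theorem hasInvariantMetric_of_countablyCompactSpace [TopologicalSpace G] [CountablyCompactSpace G]
    [TopologicalSpace Y] [MetrizableSpace Y] [ContinuousSMul G Y] : HasInvariantMetric G Y := by
  obtain ⟨ρ, rfl, hρ⟩ := exists_metricSpace_dist_le_one Y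
  have : BoundedSpace Y := Metric.boundedSpace_iff.2 ⟨1, hρ⟩
  have hemb : IsEmbedding (orbitFun G (Y := Y)) :=
    isEmbedding_orbitFun (equicontinuous_of_countablyCompactSpace continuous_smul)
  exact ⟨.induced _ hemb.injective inferInstance, hemb.eq_induced.symm, dist_orbitFun_smul⟩

theorem HasInvariantMetric.metrizableSpace_orbitRel_quotient [TopologicalSpace Y]
    (h : HasInvariantMetric G Y) [T0Space (Quotient (MulAction.orbitRel G Y))] :
    MetrizableSpace (Quotient (MulAction.orbitRel G Y)) := by
  obtain ⟨ρ, rfl, hρ⟩ := h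
  have : IsIsometricSMul G Y := ⟨fun g => .of_dist_eq (hρ g)⟩
  have := pseudoMetrizableSpace_orbitRel_quotient G Y
  infer_instance

end InvariantMetric

namespace PartialAction

variable {G X : Type*} [Group G] (η : PartialAction G X)

/-- The quotient map `G × X → X_G`. -/
def toEnv : G × X → η.EnvelopingSpace := Quotient.mk η.envSetoid

/-- The canonical map `X → X_G`, `x ↦ [1, x]`. -/
def ι (x : X) : η.EnvelopingSpace := η.toEnv (1, x)

variable {η}

theorem toEnv_surjective : Surjective η.toEnv := Quotient.mk_surjective

theorem toEnv_eq_iff {p q : G × X} : η.toEnv p = η.toEnv q ↔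
    ∃ h : (q.1⁻¹ * p.1, p.2) ∈ η.dom, η.act ⟨(q.1⁻¹ * p.1, p.2), h⟩ = q.2 :=
  Quotient.eq (r := η.envSetoid)

theorem smul_toEnv (g : G) (p : G × X) : g • η.toEnv p = η.toEnv (g * p.1, p.2) := rfl

theorem smul_ι (g : G) (x : X) : g • η.ι x = η.toEnv (g, x) := by
  rw [ι, smul_toEnv, mul_one]

theorem toEnv_eq_ι_iff {p : G × X} {y : X} : η.toEnv p = η.ι y ↔
    ∃ h : p ∈ η.dom, η.act ⟨p, h⟩ = y := by
  simp only [ι, toEnv_eq_iff, inv_one, one_mul]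

theorem ι_act (p : η.dom) : η.ι (η.act p) = p.1.1 • η.ι p.1.2 := by
  rw [smul_ι]
  exact (toEnv_eq_ι_iff.2 ⟨p.2, rfl⟩).symm

theorem ι_injective : Injective η.ι := by
  intro x y h
  obtain ⟨_, rfl⟩ := toEnv_eq_ι_iff.1 h
  exact (η.one_act x).2.symm

theorem parametrizesKernelPair_dom : ParametrizesKernelPair η.toEnv
    (fun t : G × η.dom => (t.1 * t.2.1.1⁻¹, η.act t.2)) (fun t => (t.1, t.2.1.2)) := by
  intro p q
  rw [eq_comm, toEnv_eq_iff]
  constructor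
  · rintro ⟨h, hact⟩
    exact ⟨(q.1, ⟨_, h⟩), Prod.ext (by simp) hact, rfl⟩
  · rintro ⟨⟨h, ⟨⟨k, y⟩, hky⟩⟩, rfl, rfl⟩
    have hk : (h * k⁻¹)⁻¹ * h = k := by group
    simp only [hk]
    exact ⟨hky, trivial⟩

theorem parametrizesKernelPair_sigma : ParametrizesKernelPair η.toEnv
    (fun t : Σ k : G, G × η.domAt k⁻¹ => (t.2.1 * t.1⁻¹, (η.mapAt t.1 t.2.2 : X)))
    (fun t => (t.2.1, t.2.2)) := by
  intro p q
  rw [parametrizesKernelPair_dom p q]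
  constructor
  · rintro ⟨⟨h, ⟨⟨k, y⟩, hky⟩⟩, rfl, rfl⟩
    exact ⟨⟨k, h, y, by simpa [domAt] using hky⟩, rfl, rfl⟩
  · rintro ⟨⟨k, h, y⟩, rfl, rfl⟩
    exact ⟨(h, ⟨(k, y), η.mem_dom_of_mem_domAt_inv y.2⟩), rfl, rfl⟩

variable [TopologicalSpace G] [TopologicalSpace X]

theorem isQuotientMap_toEnv : IsQuotientMap η.toEnv := isQuotientMap_quotient_mk'

theorem continuous_ι : Continuous η.ι := isQuotientMap_toEnv.continuous.comp (by fun_prop)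

theorem isOpenMap_toEnv [ContinuousMul G] (ht : η.IsTopological) : IsOpenMap η.toEnv := by
  refine parametrizesKernelPair_sigma.isOpenMap isQuotientMap_toEnv ?_ ?_
  · refine continuous_sigma fun k => ?_
    dsimp only
    exact .prodMk (by fun_prop)
      (continuous_subtype_val.comp ((ht k).2.continuous.comp continuous_snd))
  · exact isOpenMap_sigma.2 fun k => IsOpenMap.id.prodMap (ht k⁻¹).1.isOpenMap_subtype_val

theorem isProperMap_toEnv [ContinuousMul G] [ContinuousInv G] [CompactSpace G]
    (hc : η.IsContinuous) (hcl : IsClosed η.dom) : IsProperMap η.toEnv := by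
  have hact : Continuous η.act := hc
  have hsnd : IsProperMap fun e : η.dom => e.1.2 := isProperMap_snd_of_compactSpace.restrict hcl
  exact parametrizesKernelPair_dom.isProperMap isQuotientMap_toEnv (by fun_prop)
    (isProperMap_id.prodMap hsnd)

theorem metrizableSpace_envelopingSpace [ContinuousMul G] [CompactSpace G] [MetrizableSpace G]
    [MetrizableSpace X] (hc : η.IsContinuous) (ht : η.IsTopological) (hcl : IsClosed η.dom) :
    MetrizableSpace η.EnvelopingSpace := by
  have := continuousInv_of_compactSpace G
  have hproper := isProperMap_toEnv hc hcl
  have := t1Space_of_surjective_of_isClosedMap toEnv_surjective hproper.isClosedMap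
  have := pseudoMetrizableSpace_of_isProperMap_of_isOpenMap toEnv_surjective hproper
    (isOpenMap_toEnv ht)
  infer_instance

theorem continuousSMul_envelopingSpace [ContinuousMul G] (ht : η.IsTopological) :
    ContinuousSMul G η.EnvelopingSpace := by
  have hq : IsOpenQuotientMap η.toEnv :=
    ⟨toEnv_surjective, isQuotientMap_toEnv.continuous, isOpenMap_toEnv ht⟩
  refine ⟨(IsOpenQuotientMap.id.prodMap hq).continuous_comp_iff.1 ?_⟩
  change Continuous fun t : G × (G × X) => η.toEnv (t.1 * t.2.1, t.2.2)
  exact isQuotientMap_toEnv.continuous.comp (by fun_prop)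

theorem isEmbedding_ι [ContinuousMul G] (hc : η.IsContinuous) (ht : η.IsTopological) :
    IsEmbedding η.ι := by
  refine ⟨⟨le_antisymm continuous_ι.le_induced fun V hV => ?_⟩, ι_injective⟩
  obtain ⟨O, hO, hOV⟩ := isOpen_induced_iff.1 (hV.preimage hc)
  have hmem (p : η.dom) : p.1 ∈ O ↔ η.act p ∈ V := Set.ext_iff.1 hOV p
  refine isOpen_induced_iff.2 ⟨η.toEnv '' O, isOpenMap_toEnv ht O hO, ?_⟩
  ext x
  constructor
  · rintro ⟨p, hp, hpx⟩
    obtain ⟨h, rfl⟩ := toEnv_eq_ι_iff.1 hpx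
    exact (hmem ⟨p, h⟩).1 hp
  · intro hx
    obtain ⟨h, hone⟩ := η.one_act x
    exact ⟨(1, x), (hmem ⟨_, h⟩).2 (by rwa [hone]), rfl⟩

theorem hasInvariantMetric_of_envelopingSpace [ContinuousMul G] (hc : η.IsContinuous)
    (ht : η.IsTopological) (h : _root_.HasInvariantMetric G η.EnvelopingSpace) :
    η.HasInvariantMetric := by
  obtain ⟨ρ, hρ, hinv⟩ := h
  refine ⟨.induced η.ι ι_injective ρ, ?_, fun g x y => ?_⟩
  · rw [(isEmbedding_ι hc ht).eq_induced, ← hρ]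
    rfl
  · change ρ.dist (η.ι (η.act _)) (η.ι (η.act _)) = ρ.dist (η.ι x) (η.ι y)
    rw [ι_act, ι_act, hinv]

/-- The homeomorphism `X/∼_G ≃ X_G/∼_G` induced by `ι`; its inverse sends the orbit of `[g, x]`
to the orbit of `x`. -/
def orbitSpaceHomeomorph (η : PartialAction G X) :
    η.OrbitSpace ≃ₜ Quotient (MulAction.orbitRel G η.EnvelopingSpace) where
  toFun := Quotient.map η.ι (by
    rintro x _ ⟨g, h, rfl⟩
    exact ⟨g⁻¹, by simp only [ι_act, inv_smul_smul]⟩)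
  invFun := Quotient.lift
    (Quotient.lift (fun p : G × X => (Quotient.mk η.orbitSetoid p.2 : η.OrbitSpace))
      fun _ _ ⟨h, he⟩ => Quotient.sound ⟨_, h, he⟩)
    (by
      rintro _ ⟨p⟩ ⟨g, rfl⟩
      rfl)
  left_inv := by
    rintro ⟨x⟩
    rfl
  right_inv := by
    rintro ⟨⟨g, x⟩⟩
    refine Quotient.sound ⟨g⁻¹, ?_⟩
    change g⁻¹ • η.toEnv (g, x) = η.ι x
    rw [← smul_ι, inv_smul_smul]
  continuous_toFun := continuous_ι.quotient_map' _
  continuous_invFun :=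
    ((continuous_quotient_mk'.comp continuous_snd).quotient_lift _).quotient_lift _

end PartialAction

theorem theorem3p8_general {G X : Type*} [Group G] [TopologicalSpace G] [ContinuousMul G]
    [TopologicalSpace X] (η : PartialAction G X) (hc : η.IsContinuous) (ht : η.IsTopological) :
    (CountablyCompactSpace G → MetrizableSpace η.EnvelopingSpace →
      η.HasInvariantMetric ∧ HasInvariantMetric G η.EnvelopingSpace) ∧
    (CompactSpace G → MetrizableSpace G → MetrizableSpace X → IsClosed η.dom →
      η.HasInvariantMetric ∧ HasInvariantMetric G η.EnvelopingSpace) ∧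
    (CountablyCompactSpace G → MetrizableSpace η.EnvelopingSpace →
      T0Space (Quotient (MulAction.orbitRel G η.EnvelopingSpace)) →
      MetrizableSpace η.OrbitSpace) := by
  have := PartialAction.continuousSMul_envelopingSpace ht
  have hmain (_ : CountablyCompactSpace G) (_ : MetrizableSpace η.EnvelopingSpace) :
      η.HasInvariantMetric ∧ HasInvariantMetric G η.EnvelopingSpace :=
    have h := hasInvariantMetric_of_countablyCompactSpace
    ⟨PartialAction.hasInvariantMetric_of_envelopingSpace hc ht h, h⟩
  refine ⟨hmain, fun _ _ _ hcl => ?_, fun hG hX _ => ?_⟩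
  · exact hmain inferInstance (PartialAction.metrizableSpace_envelopingSpace hc ht hcl)
  · have := (hmain hG hX).2.metrizableSpace_orbitRel_quotient
    exact η.orbitSpaceHomeomorph.isEmbedding.metrizableSpace

theorem theorem3p8 {G : Type*} {X : Type*} [Group G] [TopologicalSpace G] [IsTopologicalGroup G]
    [TopologicalSpace X] (η : PartialAction G X) (hc : η.IsContinuous) (ht : η.IsTopological) :
    (CountablyCompactSpace G → TopologicalSpace.MetrizableSpace η.EnvelopingSpace →
      η.HasInvariantMetric ∧ HasInvariantMetric G η.EnvelopingSpace) ∧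
    (CompactSpace G → TopologicalSpace.MetrizableSpace G → TopologicalSpace.MetrizableSpace X →
      IsClosed η.dom →
      η.HasInvariantMetric ∧ HasInvariantMetric G η.EnvelopingSpace) ∧
    (CountablyCompactSpace G → TopologicalSpace.MetrizableSpace η.EnvelopingSpace →
      T1Space (Quotient (MulAction.orbitRel G η.EnvelopingSpace)) →
      TopologicalSpace.MetrizableSpace η.OrbitSpace) := by
  obtain ⟨h₁, h₂, h₃⟩ := theorem3p8_general η hc ht
  exact ⟨h₁, h₂, fun hG hX _ => h₃ hG hX inferInstance⟩
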